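/- Call a monoid $A$ residually finite if for all $a, b \in A$ with $a \neq b$ there are a finite monoid $B$ and a monoid morphism $\theta \colon A \to B$ with $\theta(a) \neq \theta(b)$. Let $(M_\alpha)_{\alpha \in V}$ be a family of monoids indexed by an arbitrary (possibly infinite) set $V$. Then: (1) the free product of the monoids $M_\alpha$, $\alpha \in V$, is residually finite if and only if $M_\alpha$ is residually finite for every $\alpha \in V$; (2) the restricted direct product of the monoids $M_\alpha$, $\alpha \in V$, that is, the submonoid of $\prod_{\alpha \in V} M_\alpha$ consisting of all $f$ with $f(\alpha) \neq 1_{M_\alpha}$ for only finitely many $\alpha$, is residually finite if and only if $M_\alpha$ is residually finite for every $\alpha \in V$. -/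

import Mathlib

universe u v

/-- A monoid `A` is residually finite if any two distinct elements of `A` have distinct images under
some monoid morphism from `A` to a finite monoid. Every finite monoid is isomorphic to one whose
carrier lies in `Type`, so it is no restriction to take the finite monoid there. -/
def Monoid.ResiduallyFinite (A : Type u) [Monoid A] : Prop :=
  ∀ a b : A, a ≠ b → ∃ (B : Type) (_ : Monoid B) (_ : Finite B) (θ : A →* B), θ a ≠ θ b

/-- The restricted direct product of a family of monoids: the submonoid of the direct product
consisting of the functions that take a non-identity value at only finitely many indices. -/
def Monoid.restrictedDirectProduct {V : Type u} (M : V → Type v) [∀ α, Monoid (M α)] :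
    Submonoid (∀ α, M α) where
  carrier := {f | {α | f α ≠ 1}.Finite}
  one_mem' := by simp
  mul_mem' := by
    intro f g hf hg
    refine (Set.Finite.union hf hg).subset fun α h => ?_
    by_contra hc
    simp only [Set.mem_union, Set.mem_setOf_eq, not_or, not_not] at hc
    exact h (by simp [hc.1, hc.2])

namespace Monoid

namespace ResiduallyFinite

/-! Residual finiteness passes to submonoids and, via coordinate projections, to products; only free
products of residually finite factors need work. Two distinct reduced words use finitely many
letters. Finite images of the factors, injective on these letters and 1 and trivial for unused
factors, keep the words reduced and distinct (`prod_mapOfNeOne`), and leave finitely many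
non-identity letters. Such a free product acts on the finite set of reduced words of bounded length,
where a word sends the empty word to itself (`lift_truncatedAction_prod`). -/

theorem of_separating {A : Type*} [Monoid A]
    (h : ∀ a b : A, a ≠ b → ∃ (B : Type*) (_ : Monoid B) (θ : A →* B), Finite B ∧ θ a ≠ θ b) :
    ResiduallyFinite A := by
  intro a b hab
  obtain ⟨B, _, θ, _, hθ⟩ := h a b hab
  let e : Shrink.{0} B ≃* B := Shrink.mulEquiv
  exact ⟨Shrink.{0} B, inferInstance, Finite.of_equiv B e.symm.toEquiv,
    e.symm.toMonoidHom.comp θ, fun h => hθ (e.symm.injective h)⟩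

theorem of_injective {A B : Type*} [Monoid A] [Monoid B] (f : A →* B)
    (hf : Function.Injective f) (h : ResiduallyFinite B) : ResiduallyFinite A := by
  intro a b hab
  obtain ⟨C, _, _, θ, hθ⟩ := h (f a) (f b) (hf.ne hab)
  exact ⟨C, inferInstance, inferInstance, θ.comp f, hθ⟩

theorem pi {V : Type*} {M : V → Type*} [∀ α, Monoid (M α)]
    (h : ∀ α, ResiduallyFinite (M α)) : ResiduallyFinite (∀ α, M α) := by
  intro f g hfg
  obtain ⟨α, hα⟩ := Function.ne_iff.mp hfg
  obtain ⟨C, _, _, θ, hθ⟩ := h α _ _ hα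
  exact ⟨C, inferInstance, inferInstance, θ.comp (Pi.evalMonoidHom M α), hθ⟩

/-- A residually finite monoid has a finite image in which a given finite subset embeds, trivial
when the subset has at most one element. -/
theorem exists_injOn {A : Type*} [Monoid A] (h : ResiduallyFinite A) {s : Set A}
    (hs : s.Finite) :
    ∃ (B : Type) (_ : Monoid B) (θ : A →* B),
      Finite B ∧ Set.InjOn θ s ∧ (s.Subsingleton → Subsingleton B) := by
  by_cases hss : s.Subsingleton
  · exact ⟨PUnit, inferInstance, 1, inferInstance, hss.injOn _, fun _ => inferInstance⟩
  have hsep : ∀ p : s × s, ∃ (B : Type) (_ : Monoid B) (_ : Finite B) (θ : A →* B),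
      (p.1 : A) ≠ p.2 → θ p.1 ≠ θ p.2 := by
    intro p
    by_cases hp : (p.1 : A) = p.2
    · exact ⟨PUnit, inferInstance, inferInstance, 1, fun hne => (hne hp).elim⟩
    · obtain ⟨B, hB, hfin, θ, hθ⟩ := h _ _ hp
      exact ⟨B, hB, hfin, θ, fun _ => hθ⟩
  choose B hB hfin θ hθ using hsep
  have := hs.to_subtype
  have hprod : Set.InjOn (MonoidHom.pi θ) s := by
    intro a ha b hb hab
    by_contra hne
    exact hθ (⟨a, ha⟩, ⟨b, hb⟩) hne (congrFun hab (⟨a, ha⟩, ⟨b, hb⟩))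
  let e : Shrink.{0} (∀ p, B p) ≃* ∀ p, B p := Shrink.mulEquiv
  refine ⟨Shrink.{0} (∀ p, B p), inferInstance, e.symm.toMonoidHom.comp (MonoidHom.pi θ),
    Finite.of_equiv _ e.symm.toEquiv, ?_, fun hsub => (hss hsub).elim⟩
  intro a ha b hb hab
  exact hprod ha hb (e.symm.injective hab)

end ResiduallyFinite

namespace CoprodI.Word

variable {V : Type*} {N : V → Type*} [∀ α, Monoid (N α)]

theorem finite_setOf_length_le [Finite {x : Σ α, N α // x.2 ≠ 1}] (n : ℕ) :
    {w : Word N | w.toList.length ≤ n}.Finite := by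
  have hfin := (List.finite_length_le {x : Σ α, N α // x.2 ≠ 1} n).image (List.map Subtype.val)
  refine (hfin.preimage (f := Word.toList) fun w _ w' _ h => Word.ext h).subset ?_
  intro w hw
  refine ⟨w.toList.attach.map fun x => ⟨x.1, w.ne_one x.1 x.2⟩, by simpa using hw, ?_⟩
  simp [List.map_map, Function.comp_def]

theorem length_rcons_le [∀ α, DecidableEq (N α)] {α : V} (p : Pair N α) :
    (rcons p).toList.length ≤ p.tail.toList.length + 1 := by
  unfold rcons
  split_ifs <;> simp

variable [DecidableEq V] [∀ α, DecidableEq (N α)]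

/-- The action of a factor on the reduced words of length at most `n` that multiplies a word on the
left if its part after the initial letter from this factor has length less than `n`, and fixes it
otherwise. -/
def truncatedAction (n : ℕ) (α : V) :
    N α →* Function.End {w : Word N // w.toList.length ≤ n} where
  toFun m w := if h : (equivPair α w.1).tail.toList.length < n then
      ⟨of m • w.1, (length_rcons_le _).trans h⟩ else w
  map_one' := by
    funext w
    change dite _ _ _ = w
    simp
  -- Acting by this factor changes only the head in `equivPair`, so the test on the tail has the
  -- same outcome before and after; a test on the length of the result would not.
  map_mul' m m' := by
    funext w
    change dite _ _ _ = dite _ _ _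
    by_cases h : (equivPair α w.1).tail.toList.length < n
    · simp [h, equivPair_smul_same, mul_smul]
    · simp [h]

/-- The letters rebuild the word from its right end; every proper suffix is shorter than `n`, so
truncation never intervenes. -/
theorem lift_truncatedAction_prod (n : ℕ) (w : Word N) (hw : w.toList.length ≤ n) :
    lift (truncatedAction n) w.prod ⟨empty, Nat.zero_le n⟩ = ⟨w, hw⟩ := by
  induction w using consRecOn with
  | empty => rw [prod_empty, map_one]; rfl
  | cons α m w h1 h2 ih =>
    have hlt : w.toList.length < n := by simpa using hw
    rw [prod_cons, map_mul]
    change lift (truncatedAction n) (of m) (lift (truncatedAction n) w.prod _) = _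
    rw [ih hlt.le, lift_of]
    change dite _ _ _ = _
    simp [equivPair_eq_of_fstIdx_ne h1, hlt, cons_eq_smul]

end CoprodI.Word

namespace CoprodI

open Word

variable {V : Type*}

/-- A free product with only finitely many non-identity letters is residually finite. -/
theorem residuallyFinite_of_finite_letters {N : V → Type*} [∀ α, Monoid (N α)]
    [Finite {x : Σ α, N α // x.2 ≠ 1}] : ResiduallyFinite (CoprodI N) := by
  classical
  refine .of_separating fun a b hab => ?_
  obtain ⟨w, rfl⟩ := (Word.equiv (M := N)).symm.surjective a
  obtain ⟨w', rfl⟩ := (Word.equiv (M := N)).symm.surjective b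
  set n := max w.toList.length w'.toList.length
  refine ⟨Function.End {w : Word N // w.toList.length ≤ n}, inferInstance,
    lift (truncatedAction n), ?_, fun h => hab ?_⟩
  · have : Finite {w : Word N // w.toList.length ≤ n} := (finite_setOf_length_le n).to_subtype
    exact Pi.finite
  · have := congrFun h ⟨empty, Nat.zero_le n⟩
    change lift (truncatedAction n) w.prod _ = lift (truncatedAction n) w'.prod _ at this
    rw [lift_truncatedAction_prod n w (le_max_left _ _),
      lift_truncatedAction_prod n w' (le_max_right _ _), Subtype.mk.injEq] at this
    rw [this]

variable {M : V → Type*} {N : V → Type*} [∀ α, Monoid (M α)] [∀ α, Monoid (N α)]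

/-- The letterwise image of a reduced word none of whose letters is mapped to the identity. -/
def Word.mapOfNeOne (φ : ∀ α, M α →* N α) (w : Word M)
    (h : ∀ x ∈ w.toList, φ x.1 x.2 ≠ 1) : Word N where
  toList := w.toList.map fun x => ⟨x.1, φ x.1 x.2⟩
  ne_one := List.forall_mem_map.mpr h
  chain_ne := by simpa [List.isChain_map] using w.chain_ne

theorem Word.prod_mapOfNeOne (φ : ∀ α, M α →* N α) (w : Word M)
    (h : ∀ x ∈ w.toList, φ x.1 x.2 ≠ 1) :
    (w.mapOfNeOne φ h).prod = lift (fun α => of.comp (φ α)) w.prod := by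
  simp [Word.prod, mapOfNeOne, map_list_prod, Function.comp_def]

theorem residuallyFinite (h : ∀ α, ResiduallyFinite (M α)) : ResiduallyFinite (CoprodI M) := by
  classical
  intro a b hab
  obtain ⟨w, rfl⟩ := (Word.equiv (M := M)).symm.surjective a
  obtain ⟨w', rfl⟩ := (Word.equiv (M := M)).symm.surjective b
  let L : Set (Σ α, M α) := {x | x ∈ w.toList ++ w'.toList}
  have hL : L.Finite := List.finite_toSet _
  -- Including 1 keeps letters of `L` away from the identity. For an unused factor the set is just
  -- {1}, so `N α` is trivial, which matters when `V` is infinite.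
  choose N hN φ hfin hinj hsub using fun α =>
    (h α).exists_injOn (((hL.preimage (sigma_mk_injective (i := α)).injOn)).insert 1)
  have hne : ∀ x ∈ L, x.2 ≠ 1 := fun x hx =>
    (List.mem_append.mp hx).elim (w.ne_one x) (w'.ne_one x)
  have hφ : ∀ x ∈ L, φ x.1 x.2 ≠ 1 := fun x hx hx1 =>
    hne x hx (hinj x.1 (Set.mem_insert_of_mem _ hx) (Set.mem_insert _ _) (by rw [hx1, map_one]))
  have hletters : Finite {x : Σ α, N α // x.2 ≠ 1} := by
    have : Finite (Sigma.fst '' L) := (hL.image _).to_subtype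
    refine Finite.of_injective
      (β := Σ α : (Sigma.fst '' L : Set V), N α)
      (fun x => ⟨⟨x.1.1, ?_⟩, x.1.2⟩) ?_
    · by_contra hx
      have : Subsingleton (N x.1.1) := by
        refine hsub _ ?_
        suffices Sigma.mk x.1.1 ⁻¹' L = ∅ by simp [this]
        exact Set.eq_empty_of_forall_notMem fun m hm => hx ⟨_, hm, rfl⟩
      exact x.2 (Subsingleton.elim _ _)
    · rintro ⟨⟨α, m⟩, hm⟩ ⟨⟨β, m'⟩, hm'⟩ heq
      simp only [Sigma.mk.injEq, Subtype.mk.injEq] at heq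
      obtain ⟨rfl, heq⟩ := heq
      simpa using heq
  refine (residuallyFinite_of_finite_letters (N := N) _ _ fun heq => hab ?_).imp
    fun B ⟨hB, hBfin, θ, hθ⟩ => ⟨hB, hBfin, θ.comp (lift fun α => of.comp (φ α)), hθ⟩
  change lift (fun α => of.comp (φ α)) w.prod = lift (fun α => of.comp (φ α)) w'.prod at heq
  rw [← prod_mapOfNeOne φ w fun x hx => hφ x (List.mem_append_left _ hx),
    ← prod_mapOfNeOne φ w' fun x hx => hφ x (List.mem_append_right _ hx)] at heq
  have hlist := congrArg Word.toList ((Word.equiv (M := N)).symm.injective heq)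
  have hLinj : Set.InjOn (fun x : Σ α, M α => (⟨x.1, φ x.1 x.2⟩ : Σ α, N α)) L := by
    rintro ⟨α, m⟩ hm ⟨β, m'⟩ hm' heq
    simp only [Sigma.mk.injEq] at heq
    obtain ⟨rfl, heq⟩ := heq
    rw [hinj α (Set.mem_insert_of_mem _ hm) (Set.mem_insert_of_mem _ hm') (eq_of_heq heq)]
  congr 1
  refine Word.ext (List.ext_getElem (by simpa [mapOfNeOne] using congrArg List.length hlist) ?_)
  intro i hi hi'
  refine hLinj (List.mem_append_left _ (List.getElem_mem hi))
    (List.mem_append_right _ (List.getElem_mem hi')) ?_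
  simpa [mapOfNeOne] using List.getElem_of_eq hlist (by simpa [mapOfNeOne] using hi)

end CoprodI

/-- The inclusion of a factor into the restricted direct product. -/
def restrictedDirectProduct.single {V : Type*} [DecidableEq V] (M : V → Type*)
    [∀ α, Monoid (M α)] (α : V) : M α →* restrictedDirectProduct M :=
  (MonoidHom.mulSingle M α).codRestrict _ fun m =>
    (Set.finite_singleton α).subset fun β hβ => by
      by_contra hne
      exact hβ (Pi.mulSingle_eq_of_ne hne m)

theorem restrictedDirectProduct.single_injective {V : Type*} [DecidableEq V] (M : V → Type*)
    [∀ α, Monoid (M α)] (α : V) : Function.Injective (single M α) := fun _ _ h =>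
  Pi.mulSingle_injective α (congrArg Subtype.val h)

end Monoid

/-- The free product of a family of monoids (Mathlib's `Monoid.CoprodI`: the free monoid on the
disjoint union of the factors modulo the relations identifying the identities with the empty word
and two-letter words in one factor with their product) and the restricted direct product of the
family are each residually finite if and only if every factor is. -/
theorem corollary5p2 {V : Type u} (M : V → Type v) [∀ α, Monoid (M α)] :
    (Monoid.ResiduallyFinite (Monoid.CoprodI M) ↔ ∀ α, Monoid.ResiduallyFinite (M α)) ∧
    (Monoid.ResiduallyFinite (Monoid.restrictedDirectProduct M) ↔
      ∀ α, Monoid.ResiduallyFinite (M α)) := by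
  classical
  exact ⟨⟨fun h α => h.of_injective _ (Monoid.CoprodI.of_injective α),
      Monoid.CoprodI.residuallyFinite⟩,
    ⟨fun h α => h.of_injective _ (Monoid.restrictedDirectProduct.single_injective M α),
      fun h => (Monoid.ResiduallyFinite.pi h).of_injective _ (Submonoid.subtype_injective _)⟩⟩
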